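/- All rings are associative with identity. Let $R$ be a nonzero ring that is left self-injective (that is, $R$ is injective as a left $R$-module), and let $G$ be an infinite locally finite group (every finitely generated subgroup of $G$ is finite). Then the group ring $R(G)$ is left FP-injective, that is, $\operatorname{Ext}^1_{R(G)}(F,R(G))=0$ for every finitely presented left $R(G)$-module $F$, but $R(G)$ is not left self-injective. -/

import Mathlib

universe u v

/-- A left module `M` over a ring `S` is *FP-injective* (absolutely pure) if
`Ext¹_S(F, M) = 0` for every finitely presented left `S`-module `F`.
Every finitely presented module is isomorphic to one in the universe `v`, since `S` is `v`-small,
so restricting `F` to that universe loses nothing. -/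
def IsFPInjectiveModule (S : Type u) [Ring S] [Small.{v} S]
    (M : Type v) [AddCommGroup M] [Module S M] : Prop :=
  ∀ F : ModuleCat.{v} S, Module.FinitePresentation S F →
    Subsingleton (CategoryTheory.Abelian.Ext.{v} F (ModuleCat.of S M) 1)

/-- A ring is *left FP-injective* if it is FP-injective as a left module over itself. -/
def IsLeftFPInjectiveRing (S : Type u) [Ring S] : Prop :=
  IsFPInjectiveModule S S

/-- A ring is *left self-injective* if it is injective as a left module over itself. -/
def IsLeftSelfInjectiveRing (S : Type u) [Ring S] : Prop :=
  Module.Injective S S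

/-- A group is *locally finite* if each of its finitely generated subgroups is finite. -/
def IsLocallyFiniteGroup (G : Type u) [Group G] : Prop :=
  ∀ H : Subgroup G, H.FG → Finite H

/-! FP-injectivity: a homomorphism from a finitely generated submodule of `R[G]^n` to `R[G]`
involves finitely many group elements, hence a finite subgroup `H`. Extend its coefficient at 1 over
`R`, then recover the other coefficients by translating along `H` (`exists_extend_of_fg`). Failure
of injectivity: self-injectivity would make every almost invariant function invariant up to finite
support. An infinite, co-infinite almost invariant subset of an infinite subgroup contradicts this.
-/

namespace MonoidAlgebra

/-! ### Self-injectivity and almost invariant functions -/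

section Convolution

variable {R : Type u} [Ring R] {G : Type v} [Group G]

/-- Left convolution of an arbitrary function `u : G → R` by an element of the group ring. -/
noncomputable def convFun (w : G → R) : MonoidAlgebra R G →+ (G → R) where
  toFun a g := a.coeff.sum fun k r => r * w (k⁻¹ * g)
  map_zero' := by ext; simp
  map_add' a b := by
    ext g
    simp only [coeff_add, Pi.add_apply]
    exact Finsupp.sum_add_index' (by simp) (by simp [add_mul])

theorem convFun_apply (w : G → R) (a : MonoidAlgebra R G) (g : G) :
    convFun w a g = a.coeff.sum fun k r => r * w (k⁻¹ * g) := rfl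

theorem convFun_single (w : G → R) (k : G) (r : R) (g : G) :
    convFun w (single k r) g = r * w (k⁻¹ * g) := by
  simp [convFun_apply]

theorem convFun_coeff (a y : MonoidAlgebra R G) : convFun y.coeff a = (a * y).coeff := by
  ext g
  rw [convFun_apply, coeff_mul_apply_left]

theorem convFun_mul (w : G → R) (a b : MonoidAlgebra R G) :
    convFun w (a * b) = convFun (convFun w b) a := by
  induction a using induction_linear with
  | zero => simp
  | add a a' ha ha' => rw [add_mul, map_add, map_add, ha, ha']
  | single k r =>
    induction b using induction_linear with
    | zero => ext g; simp [convFun_single]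
    | add b b' hb hb' =>
      rw [mul_add, map_add, hb, hb']
      ext g
      simp [convFun_single, mul_add]
    | single l s =>
      ext g
      simp [convFun_single, mul_assoc]

/-- The pairs `(a, y)` in `R[G] × R[G]` such that the convolution of `w` by `a` is `y`. -/
noncomputable def convGraph (w : G → R) :
    Submodule (MonoidAlgebra R G) (MonoidAlgebra R G × MonoidAlgebra R G) where
  carrier := {p | convFun w p.1 = p.2.coeff}
  zero_mem' := by ext; simp
  add_mem' {p q} hp hq := by
    simp only [Set.mem_ofPred_eq] at *
    rw [Prod.fst_add, map_add, hp, hq, Prod.snd_add, coeff_add, Finsupp.coe_add]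
  smul_mem' c p hp := by
    simp only [Set.mem_ofPred_eq] at *
    rw [Prod.smul_fst, Prod.smul_snd, smul_eq_mul, smul_eq_mul, convFun_mul, hp, convFun_coeff]

theorem mem_convGraph {w : G → R} {p : MonoidAlgebra R G × MonoidAlgebra R G} :
    p ∈ convGraph w ↔ convFun w p.1 = p.2.coeff := Iff.rfl

/-- If `R[G]` is left self-injective, a function on `G` which is almost invariant under left
translation by `H` differs from an `H`-invariant one by a finitely supported function. -/
theorem exists_sub_coeff_invariant [hS : Module.Injective (MonoidAlgebra R G) (MonoidAlgebra R G)]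
    (H : Set G) (w : G → R) (hw : ∀ k ∈ H, {g | w (k⁻¹ * g) ≠ w g}.Finite) :
    ∃ x : MonoidAlgebra R G, ∀ k ∈ H, ∀ g,
      w (k⁻¹ * g) - x.coeff (k⁻¹ * g) = w g - x.coeff g := by
  -- The graph projects injectively onto the left ideal of those `a` with `a * w` finitely
  -- supported; `h` extends `a ↦ a * w` from it, so `h` is right multiplication by `h 1`.
  obtain ⟨h, hh⟩ := hS.out
    ((LinearMap.fst (MonoidAlgebra R G) (MonoidAlgebra R G) (MonoidAlgebra R G)).comp
      (convGraph w).subtype)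
    (by
      rintro ⟨⟨a, y⟩, hp⟩ ⟨⟨b, z⟩, hq⟩ hab
      obtain rfl : a = b := hab
      obtain rfl : y = z := coeff_injective <| DFunLike.coe_injective <|
        (mem_convGraph.1 hp).symm.trans (mem_convGraph.1 hq)
      rfl)
    ((LinearMap.snd (MonoidAlgebra R G) (MonoidAlgebra R G) (MonoidAlgebra R G)).comp
      (convGraph w).subtype)
  refine ⟨h 1, fun k hk g => ?_⟩
  let y : MonoidAlgebra R G := ofCoeff <| Finsupp.ofSupportFinite (fun g => w (k⁻¹ * g) - w g)
    ((hw k hk).subset fun g hg => by simpa [sub_eq_zero] using hg)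
  have hy : ∀ g, y.coeff g = w (k⁻¹ * g) - w g := fun _ => rfl
  have hp : (single k 1 - 1, y) ∈ convGraph w := by
    rw [mem_convGraph]
    ext g
    rw [hy, map_sub, Pi.sub_apply, one_def, convFun_single, convFun_single]
    simp
  have hxy : h (single k 1 - 1) = y := hh ⟨_, hp⟩
  have : h (single k 1 - 1) = (single k 1 - 1) * h 1 := by
    rw [← smul_eq_mul, ← map_smul, smul_eq_mul, mul_one]
  rw [this, sub_mul, one_mul] at hxy
  have hg := DFunLike.congr_fun (congrArg coeff hxy) g
  rw [hy, coeff_sub, Finsupp.sub_apply, coeff_single_mul_apply, one_mul] at hg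
  rw [sub_eq_sub_iff_sub_eq_sub, hg]

end Convolution

/-! ### Extension through a finite subgroup -/

section Extension

variable {R : Type u} [Ring R] {G : Type v} [Group G]
variable {M : Type*} [AddCommGroup M] [Module R M] [Module (MonoidAlgebra R G) M]

/-- The map `x ↦ ∑ h, ψ (h⁻¹ x) h` to the group ring induced by an `R`-linear form `ψ`,
the sum running over a finite subgroup. -/
noncomputable def coinduce (H : Subgroup G) [Fintype H] (ψ : M →ₗ[R] R) :
    M →+ MonoidAlgebra R G where
  toFun x := ∑ h : H, single (h : G) (ψ ((single (h : G)⁻¹ (1 : R) : MonoidAlgebra R G) • x))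
  map_zero' := by simp
  map_add' x y := by simp [smul_add, single_add, Finset.sum_add_distrib]

theorem coinduce_apply (H : Subgroup G) [Fintype H] (ψ : M →ₗ[R] R) (x : M) :
    coinduce H ψ x =
      ∑ h : H, single (h : G) (ψ ((single (h : G)⁻¹ (1 : R) : MonoidAlgebra R G) • x)) := rfl

variable [IsScalarTower R (MonoidAlgebra R G) M]

theorem coinduce_single_smul (H : Subgroup G) [Fintype H] (ψ : M →ₗ[R] R) (k : H) (r : R)
    (x : M) :
    coinduce H ψ ((single (k : G) r : MonoidAlgebra R G) • x) =
      single (k : G) r * coinduce H ψ x := by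
  rw [coinduce_apply, coinduce_apply, Finset.mul_sum, ← Equiv.sum_comp (Equiv.mulLeft k)]
  refine Finset.sum_congr rfl fun h _ => ?_
  have : (single (h : G)⁻¹ r : MonoidAlgebra R G) = r • single (h : G)⁻¹ (1 : R) := by simp
  rw [← mul_smul, single_mul_single, single_mul_single, Equiv.coe_mulLeft, Subgroup.coe_mul,
    mul_inv_rev, inv_mul_cancel_right, one_mul, this, smul_assoc, map_smul, smul_eq_mul]

theorem coinduce_smul (H : Subgroup G) [Fintype H] (ψ : M →ₗ[R] R) (a : MonoidAlgebra R G)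
    (ha : ∀ g ∈ a.coeff.support, g ∈ H) (x : M) :
    coinduce H ψ (a • x) = a * coinduce H ψ x := by
  conv_lhs => rw [← sum_coeff_single a]
  conv_rhs => rw [← sum_coeff_single a]
  rw [Finsupp.sum, Finset.sum_smul, map_sum, Finset.sum_mul]
  exact Finset.sum_congr rfl fun g hg => coinduce_single_smul H ψ ⟨g, ha g hg⟩ _ x

/-- Over a left self-injective ring, homomorphisms from finitely generated submodules of finite free
modules over the group ring of a locally finite group to the group ring extend. -/
theorem exists_extend_of_fg [hR : Module.Injective R R] (hG : IsLocallyFiniteGroup G)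
    {ι : Type*} [Fintype ι]
    {N : Submodule (MonoidAlgebra R G) (ι → MonoidAlgebra R G)} (hN : N.FG)
    (f : N →ₗ[MonoidAlgebra R G] MonoidAlgebra R G) :
    ∃ g : (ι → MonoidAlgebra R G) →ₗ[MonoidAlgebra R G] MonoidAlgebra R G,
      g ∘ₗ N.subtype = f := by
  classical
  obtain ⟨s, hs⟩ := hN
  have hsN : ∀ x ∈ s, x ∈ N := fun x hx => hs ▸ Submodule.subset_span hx
  let ε : MonoidAlgebra R G →ₗ[R] R :=
    { toFun := fun a => a.coeff 1
      map_add' := fun _ _ => rfl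
      map_smul' := fun _ _ => rfl }
  let T : Finset G :=
    (s.biUnion fun x => Finset.univ.biUnion fun i => (x i).coeff.support) ∪
      s.attach.biUnion fun x => (f ⟨x, hsN x x.2⟩).coeff.support
  let H := Subgroup.closure (T : Set G)
  have : Finite H := hG H ⟨T, rfl⟩
  let := Fintype.ofFinite H
  obtain ⟨ψ, hψ⟩ := Module.Injective.extension_property R R _ _
    ((N.subtype).restrictScalars R) N.injective_subtype (ε ∘ₗ f.restrictScalars R)
  have hψ' : ∀ x : N, ψ x = (f x).coeff 1 := fun x => DFunLike.congr_fun hψ x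
  -- `coinduce H ψ` is linear only over `R[H]`, so only its values on the basis are kept. This
  -- suffices on the generators, whose coordinates lie in `R[H]`.
  refine ⟨Fintype.linearCombination (MonoidAlgebra R G)
    (fun i => coinduce H ψ (Pi.single i 1)), ?_⟩
  refine LinearMap.ext_on_range (v := fun x : s => (⟨x, hsN x x.2⟩ : N)) ?_ ?_
  · have hspan := Submodule.span_span_coe_preimage (R := MonoidAlgebra R G)
      (s := (s : Set (ι → MonoidAlgebra R G)))
    subst hs
    convert hspan using 2
    ext x
    simp [Subtype.ext_iff, eq_comm]
  rintro ⟨x, hx⟩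
  have hxN : x ∈ N := hsN x hx
  have hsupp : ∀ i, ∀ g ∈ (x i).coeff.support, g ∈ H := fun i g hg =>
    Subgroup.subset_closure <| Finset.mem_coe.2 <| Finset.mem_union_left _ <|
      Finset.mem_biUnion.2 ⟨x, hx, Finset.mem_biUnion.2 ⟨i, Finset.mem_univ _, hg⟩⟩
  have hsupp' : ∀ g ∈ (f ⟨x, hxN⟩).coeff.support, g ∈ H := fun g hg =>
    Subgroup.subset_closure <| Finset.mem_coe.2 <| Finset.mem_union_right _ <|
      Finset.mem_biUnion.2 ⟨⟨x, hx⟩, Finset.mem_attach _ _, hg⟩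
  calc Fintype.linearCombination (MonoidAlgebra R G) (fun i => coinduce H ψ (Pi.single i 1)) x
      = ∑ i, x i * coinduce H ψ (Pi.single i 1) := by
        simp [Fintype.linearCombination_apply]
    _ = coinduce H ψ (∑ i, x i • Pi.single i (1 : MonoidAlgebra R G)) := by
        rw [map_sum]
        exact Finset.sum_congr rfl fun i _ => (coinduce_smul H ψ (x i) (hsupp i) _).symm
    _ = coinduce H ψ x := by rw [← pi_eq_sum_univ' x]
    _ = ∑ h : H, single (h : G) ((f ⟨x, hxN⟩).coeff h) := by
        refine Finset.sum_congr rfl fun h _ => ?_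
        have := hψ' ((single (h : G)⁻¹ (1 : R) : MonoidAlgebra R G) • ⟨x, hxN⟩)
        rw [Submodule.coe_smul] at this
        rw [this, map_smul, smul_eq_mul, coeff_single_mul_apply]
        simp
    _ = f ⟨x, hxN⟩ := by
        ext g
        rw [coeff_sum, Finsupp.finsetSum_apply]
        simp only [coeff_single, Finsupp.single_apply]
        by_cases hg : g ∈ H
        · rw [Finset.sum_eq_single ⟨g, hg⟩]
          · simp
          · intro h _ hne
            exact if_neg fun e => hne (Subtype.ext e)
          · simp
        · rw [Finset.sum_eq_zero fun (h : H) _ => if_neg fun (e : (h : G) = g) => hg (e ▸ h.2)]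
          exact (Finsupp.notMem_support_iff.1 fun h => hg (hsupp' g h)).symm

end Extension

end MonoidAlgebra

/-! ### Almost invariant sets -/

/-- An infinite set of natural numbers splits into two infinite parts. -/
theorem Set.Infinite.exists_split {V : Set ℕ} (hV : V.Infinite) :
    ∃ c : Set ℕ, (V ∩ c).Infinite ∧ (V ∩ cᶜ).Infinite := by
  have := hV.to_subtype
  let e : ℕ ↪ V := _root_.Infinite.natEmbedding V
  have he : Function.Injective fun n => (e n : ℕ) := Subtype.val_injective.comp e.injective
  refine ⟨Set.range fun n => (e (2 * n) : ℕ), ?_, ?_⟩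
  · refine (Set.infinite_range_of_injective (f := fun n => (e (2 * n) : ℕ))
      fun a b h => by have := he h; omega).mono ?_
    rintro _ ⟨n, rfl⟩
    exact ⟨(e _).2, n, rfl⟩
  · refine (Set.infinite_range_of_injective (f := fun n => (e (2 * n + 1) : ℕ))
      fun a b h => by have := he h; omega).mono ?_
    rintro _ ⟨n, rfl⟩
    refine ⟨(e _).2, ?_⟩
    rintro ⟨m, hm⟩
    have := he hm
    omega

/-- An infinite locally finite group has an infinite subgroup `H` with an almost invariant subset
that is neither finite nor cofinite in `H`. -/
theorem IsLocallyFiniteGroup.exists_almost_invariant {G : Type u} [Group G] [Infinite G]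
    (hG : IsLocallyFiniteGroup G) :
    ∃ (H : Subgroup G) (A : Set G), A ⊆ H ∧ A.Infinite ∧ (H \ A : Set G).Infinite ∧
      ∀ k ∈ H, {g | ¬ (k⁻¹ * g ∈ A ↔ g ∈ A)}.Finite := by
  classical
  let s : ℕ ↪ G := Infinite.natEmbedding G
  let K : ℕ → Subgroup G := fun n => Subgroup.closure (((Finset.range n).image s : Finset G))
  have hKfin : ∀ n, (K n : Set G).Finite := fun n =>
    Set.finite_coe_iff.1 <| hG (K n) ⟨_, rfl⟩
  have hKmono : Monotone K := fun m n h => Subgroup.closure_mono <| by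
    exact_mod_cast Finset.image_subset_image (Finset.range_mono h)
  let H : Subgroup G := ⨆ n, K n
  have hH : ∀ g, g ∈ H ↔ ∃ n, g ∈ K n := fun g =>
    Subgroup.mem_iSup_of_directed hKmono.directed_le
  let ρ : G → ℕ := fun g => sInf {n | g ∈ K n}
  have hρ : ∀ g ∈ H, g ∈ K (ρ g) := fun g hg => Nat.sInf_mem ((hH g).1 hg)
  have hHinf : (H : Set G).Infinite :=
    (Set.infinite_range_of_injective s.injective).mono <| by
      rintro _ ⟨n, rfl⟩
      exact (hH _).2 ⟨n + 1, Subgroup.subset_closure <| by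
        exact_mod_cast Finset.mem_image_of_mem s (Finset.self_mem_range_succ n)⟩
  have hV : (ρ '' H).Infinite := fun hfin => hHinf <|
    (hfin.biUnion fun n _ => hKfin n).subset fun g hg =>
      Set.mem_biUnion (Set.mem_image_of_mem ρ hg) (hρ g hg)
  obtain ⟨c, hc, hc'⟩ := hV.exists_split
  refine ⟨H, {g | g ∈ H ∧ ρ g ∈ c}, fun g hg => hg.1, ?_, ?_, fun k hk => ?_⟩
  · refine Set.Infinite.of_image ρ (hc.mono ?_)
    rintro _ ⟨⟨g, hg, rfl⟩, hgc⟩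
    exact ⟨g, ⟨hg, hgc⟩, rfl⟩
  · refine Set.Infinite.of_image ρ (hc'.mono ?_)
    rintro _ ⟨⟨g, hg, rfl⟩, hgc⟩
    exact ⟨g, ⟨hg, fun h => hgc h.2⟩, rfl⟩
  -- Outside the finite group `K (ρ k)`, translation by `k⁻¹` preserves the level `ρ`, hence
  -- membership in a union of levels.
  · refine (hKfin (ρ k)).subset fun g hg => ?_
    by_contra hgK
    have hkn : ∀ n, k⁻¹ * g ∈ K n ↔ g ∈ K n := by
      intro n
      rcases le_total (ρ k) n with h | h
      · exact (K n).mul_mem_cancel_left ((K n).inv_mem (hKmono h (hρ k hk)))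
      · refine ⟨fun h' => absurd ?_ hgK, fun h' => absurd (hKmono h h') hgK⟩
        exact ((K (ρ k)).mul_mem_cancel_left ((K _).inv_mem (hρ k hk))).1 (hKmono h h')
    have hρeq : ρ (k⁻¹ * g) = ρ g := by simp only [ρ, hkn]
    refine hg ?_
    simp only [Set.mem_ofPred_eq, hρeq, H.mul_mem_cancel_left (H.inv_mem hk)]

/-- Off the support of the finite correction, an `H`-invariant function would take both values 1 and
0 on `H`. -/
theorem MonoidAlgebra.not_injective_of_infinite {R : Type u} [Ring R] [Nontrivial R] {G : Type v}
    [Group G] [Infinite G] (hG : IsLocallyFiniteGroup G) :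
    ¬ Module.Injective (MonoidAlgebra R G) (MonoidAlgebra R G) := by
  classical
  intro hS
  obtain ⟨H, A, hAH, hA, hA', hk⟩ := hG.exists_almost_invariant
  obtain ⟨x, hx⟩ := exists_sub_coeff_invariant (H : Set G) (A.indicator (1 : G → R))
    fun k hkH => (hk k hkH).subset fun g hg h => hg <| by
      by_cases hgA : g ∈ A
      · rw [Set.indicator_of_mem hgA, Set.indicator_of_mem (h.2 hgA)]; rfl
      · rw [Set.indicator_of_notMem hgA, Set.indicator_of_notMem (fun h' => hgA (h.1 h'))]
  obtain ⟨a, ha, hax⟩ := hA.exists_notMem_finset x.coeff.support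
  obtain ⟨b, ⟨hbH, hb⟩, hbx⟩ := hA'.exists_notMem_finset x.coeff.support
  have := hx (a * b⁻¹) (H.mul_mem (hAH ha) (H.inv_mem hbH)) a
  rw [show (a * b⁻¹)⁻¹ * a = b by group, Finsupp.notMem_support_iff.1 hax,
    Finsupp.notMem_support_iff.1 hbx, Set.indicator_of_mem ha, Set.indicator_of_notMem hb] at this
  simp at this

open CategoryTheory in
/-- `Ext¹` out of a quotient of a projective module vanishes if homomorphisms from the kernel
extend. -/
theorem ModuleCat.subsingleton_ext_one_of_extend {S : Type u} [Ring S] [Small.{v} S]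
    {P : Type v} [AddCommGroup P] [Module S P] [Module.Projective S P] (F M : ModuleCat.{v} S)
    (p : P →ₗ[S] F) (hp : Function.Surjective p)
    (h : ∀ f : LinearMap.ker p →ₗ[S] M, ∃ g : P →ₗ[S] M, g ∘ₗ (LinearMap.ker p).subtype = f) :
    Subsingleton (Abelian.Ext.{v} F M 1) := by
  let T : ShortComplex (ModuleCat.{v} S) :=
    ShortComplex.mk (ModuleCat.ofHom (LinearMap.ker p).subtype) (ModuleCat.ofHom p) (by
      ext x
      exact x.2)
  have hT : T.ShortExact :=
    { exact := by
        rw [ShortComplex.ShortExact.moduleCat_exact_iff_function_exact]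
        exact LinearMap.exact_subtype_ker_map p
      mono_f := (ModuleCat.mono_iff_injective _).2 Subtype.val_injective
      epi_g := (ModuleCat.epi_iff_surjective _).2 hp }
  have : CategoryTheory.Projective T.X₂ :=
    ModuleCat.projective_of_categoryTheory_projective (ModuleCat.of S P)
  refine subsingleton_of_forall_eq 0 fun e => ?_
  -- As `P` is projective, every class is the pushout of the extension class along some map from the
  -- kernel; it dies once that map extends to `P`.
  obtain ⟨y, rfl⟩ := Abelian.Ext.contravariant_sequence_exact₃ hT M e
    (Abelian.Ext.eq_zero_of_projective _) (add_zero 1)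
  obtain ⟨f, rfl⟩ := Abelian.Ext.mk₀_bijective _ _ |>.2 y
  obtain ⟨g, hg⟩ := h f.hom
  have : f = T.f ≫ ModuleCat.ofHom g := by
    ext x
    exact (DFunLike.congr_fun hg x).symm
  rw [this, ← Abelian.Ext.mk₀_comp_mk₀, ← Abelian.Ext.comp_assoc_of_second_deg_zero,
    hT.extClass_comp, Abelian.Ext.zero_comp]

theorem mainTheorem11 {R : Type u} [Ring R] [Nontrivial R] {G : Type v} [Group G] [Infinite G]
    (hR : IsLeftSelfInjectiveRing R) (hG : IsLocallyFiniteGroup G) :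
    IsLeftFPInjectiveRing (MonoidAlgebra R G) ∧
      ¬ IsLeftSelfInjectiveRing (MonoidAlgebra R G) := by
  refine ⟨fun F hF => ?_, MonoidAlgebra.not_injective_of_infinite hG⟩
  have : Module.Injective R R := hR
  obtain ⟨n, K, e, hK⟩ := Module.FinitePresentation.exists_fin (MonoidAlgebra R G) F
  have hker : LinearMap.ker (e.symm.toLinearMap ∘ₗ K.mkQ) = K := by
    rw [LinearEquiv.ker_comp, Submodule.ker_mkQ]
  refine ModuleCat.subsingleton_ext_one_of_extend F _ (e.symm.toLinearMap ∘ₗ K.mkQ)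
    (e.symm.surjective.comp K.mkQ_surjective) fun f => ?_
  exact MonoidAlgebra.exists_extend_of_fg hG (hker.symm ▸ hK) f
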